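/- Let $K=\mathbb R$ or $K=\mathbb C$, let $(T,d)$ be a compact metric space with at least two points and Borel $\sigma$-algebra $\mathcal B$, let $n\ge 1$, and give $K^n$ its Euclidean norm and scalar product $\langle x,y\rangle=\sum_i x_i\overline{y_i}$. For a map $f$ on $T$ with values in a metric space $(Y,\rho)$ let $\|f\|_L=\sup_{x\ne y}\rho(f(x),f(y))/d(x,y)$. Let $cabv(K^n)$ be the space of $\sigma$-additive $\mu:\mathcal B\to K^n$ of finite total variation, with $\|\mu\|=|\mu|(T)$. For $\mu\in cabv(K^n)$, $\int f\,d\mu$ denotes the integral of functions $f:T\to K^n$ that are uniform limits of simple functions, determined by $\int \sum_i\varphi_{A_i}x_i\,d\mu=\sum_i\langle x_i,\mu(A_i)\rangle$ and uniform limits. The weak* topology on $cabv(K^n)\equiv C(T,K^n)'$ is that of pointwise convergence of $f\mapsto\int f\,d\mu$ on the continuous functions $f:T\to K^n$. For $a>0$ and $v\in K^n$ put $B_a(K^n,v)=\{\mu\in cabv(K^n): \|\mu\|\le a,\ \mu(T)=v\}$. For $\mu,\nu\in cabv(K^n)$ with $\mu(T)=\nu(T)$ put $d^*_{MK}(\mu,\nu)=\sup\{|\int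 f\,d(\mu-\nu)| : f:T\to K^n,\ \|f\|_L\le 1\}$. Let $(\omega_i)_{i\ge1}$ be Lipschitz maps $T\to T$ whose Lipschitz constants $r_i=\|\omega_i\|_L$ form a bounded sequence, let $(R_i)_{i\ge1}$ be linear operators on $K^n$ with $\sum_i\|R_i\|<\infty$ (operator norms), let $H:cabv(K^n)\to cabv(K^n)$ be the Markov-type operator $H(\mu)(B)=\sum_{i\ge1}R_i\big(\mu(\omega_i^{-1}(B))\big)$, and put $c=\sum_{i\ge1}\|R_i\|\,r_i$. (Main assertion.) Assume a) $\sum_{i\ge1}R_i=Id_{K^n}$; b) $c<1$; c) $0<a<\infty$, $v\in K^n$ and $\|v\|\le a$; d) $\emptyset\ne A\subseteq B_a(K^n,v)$ is weak* closed and $H(A)\subseteq A$. Then, $A$ being equipped with the metric $d^*_{MK}$, the map $H_1:A\to A$, $H_1(\mu)=H(\mu)$, is a contraction with contraction factor $\le c$, and there is a unique $\mu^*\in A$ with $H(\mu^*)=\mu^*$. (Particular cases.) i) If all $r_i<1$ and $\sum_i\|R_i\|=1$, then $c<1$. ii) Under c), $B_a(K^n,v)\neq\emptyset$. iii) If $\sum_i\|R_i\|=1$,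 then $\|H(\mu)\|\le\|\mu\|$ for all $\mu\in cabv(K^n)$. iv) Under a) and c), if $\|H(\mu)\|\le\|\mu\|$ for all $\mu\in cabv(K^n)$, then one can take $A=B_a(K^n,v)$ in d), that is, $H(B_a(K^n,v))\subseteq B_a(K^n,v)$ and $B_a(K^n,v)$ is weak* closed. -/

import Mathlib

open MeasureTheory
open scoped ENNReal Topology

namespace SelfSimilar

/-- The Lipschitz constant `‖f‖_L = sup {d(f x, f y) / d(x, y) | x ≠ y}`. -/
noncomputable def lipConst {T Y : Type*} [MetricSpace T] [MetricSpace Y] (f : T → Y) : ℝ :=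
  sSup {r : ℝ | ∃ x y : T, x ≠ y ∧ r = dist (f x) (f y) / dist x y}

section Cabv

variable (𝕜 : Type*) [RCLike 𝕜] (T : Type*) [MeasurableSpace T]
  (E : Type*) [NormedAddCommGroup E] [NormedSpace 𝕜 E]

/-- `cabv(E)`: the vector space of `σ`-additive measures of finite total variation. -/
noncomputable def cabv : Submodule 𝕜 (VectorMeasure T E) where
  carrier := {μ | μ.variation Set.univ < ∞}
  zero_mem' := by simp
  add_mem' := by
    intro μ ν hμ hν
    refine lt_of_le_of_lt (VectorMeasure.variation_add_le Set.univ) ?_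
    simpa using ⟨hμ, hν⟩
  smul_mem' := by
    intro c μ hμ
    change (c • μ).variation Set.univ < ∞
    rw [VectorMeasure.variation_smul, Measure.smul_apply]
    exact ENNReal.mul_lt_top (by simp) hμ

end Cabv

section Norms

variable {𝕜 : Type*} [RCLike 𝕜] {T : Type*} [MeasurableSpace T]
  {E : Type*} [NormedAddCommGroup E]

/-- The variational norm `‖μ‖ = |μ|(T)`. -/
noncomputable def varNorm [NormedSpace 𝕜 E] (μ : cabv 𝕜 T E) : ℝ :=
  ((μ : VectorMeasure T E).variation Set.univ).toReal

/-- `B_a(E, v)`: the measures `μ` with `‖μ‖ ≤ a` and `μ(T) = v`. -/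
def ballMass [NormedSpace 𝕜 E] (a : ℝ) (v : E) : Set (cabv 𝕜 T E) :=
  {μ | varNorm μ ≤ a ∧ (μ : VectorMeasure T E) Set.univ = v}

variable [InnerProductSpace 𝕜 E] [NormedSpace ℝ E] [IsScalarTower ℝ 𝕜 E]

variable (𝕜 E) in
/-- The scalar product `(x, y) ↦ <x, y>`, linear in `x` and antilinear in `y`, seen as a
continuous real-bilinear map. In Mathlib `inner` is antilinear in its first argument. -/
noncomputable def pairing : E →L[ℝ] E →L[ℝ] 𝕜 :=
  LinearMap.mkContinuous₂
    (LinearMap.mk₂ ℝ (fun x y : E => inner 𝕜 y x)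
      (fun x x' y => inner_add_right y x x')
      (fun c x y => by
        rw [← algebraMap_smul 𝕜 c x, inner_smul_right, Algebra.smul_def])
      (fun x y y' => inner_add_left y y' x)
      (fun c x y => by
        rw [← algebraMap_smul 𝕜 c y, inner_smul_left, Algebra.smul_def]
        simp))
    1 (fun x y => by simpa [mul_comm] using norm_inner_le_norm (𝕜 := 𝕜) y x)

/-- The integral `∫ f dμ`, which sends `φ_A x` to `<x, μ(A)>`; on uniform limits of simple
functions it is the limit of the integrals of the simple functions. -/
noncomputable def vint (f : T → E) (μ : cabv 𝕜 T E) : 𝕜 :=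
  (μ : VectorMeasure T E).integral f (pairing 𝕜 E)

/-- The modified Monge-Kantorovich norm `sup {|∫ f dμ| : ‖f‖_L ≤ 1}` (for `μ(T) = 0`). -/
noncomputable def normMKStar [MetricSpace T] (μ : cabv 𝕜 T E) : ℝ :=
  sSup {r : ℝ | ∃ f : T → E, LipschitzWith 1 f ∧ r = ‖vint f μ‖}

/-- The distance `d*_MK(μ, ν) = ‖μ - ν‖*_MK` (for `μ(T) = ν(T)`). -/
noncomputable def dMKStar [MetricSpace T] (μ ν : cabv 𝕜 T E) : ℝ := normMKStar (μ - ν)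

/-- The weak* topology on `cabv(E) ≡ C(T, E)'`: the topology of pointwise convergence on
`C(T, E)` of the functionals `f ↦ ∫ f dμ`. -/
noncomputable abbrev weakStar [MetricSpace T] : TopologicalSpace (cabv 𝕜 T E) :=
  TopologicalSpace.induced (fun (μ : cabv 𝕜 T E) (f : C(T, E)) => vint f μ) inferInstance

/-- `A` is closed in the weak* topology. -/
def WeakStarClosed [MetricSpace T] (A : Set (cabv 𝕜 T E)) : Prop :=
  IsClosed[weakStar] A

end Norms

section Markov

variable {𝕜 : Type*} [RCLike 𝕜] {T : Type*} [MeasurableSpace T]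
  {E : Type*} [NormedAddCommGroup E] [NormedSpace 𝕜 E]

theorem norm_map_le (μ : cabv 𝕜 T E) {w : T → T} (hw : Measurable w) {B : Set T}
    (hB : MeasurableSet B) :
    ‖(μ : VectorMeasure T E).map w B‖ ≤
      ((μ : VectorMeasure T E).variation (w ⁻¹' B)).toReal := by
  rw [VectorMeasure.map_apply _ hw hB]
  exact VectorMeasure.norm_measure_le_variation
    ((measure_mono (Set.subset_univ _)).trans_lt μ.2).ne

theorem norm_map_le_varNorm (μ : cabv 𝕜 T E) {w : T → T} (hw : Measurable w) (B : Set T) :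
    ‖(μ : VectorMeasure T E).map w B‖ ≤ varNorm μ := by
  by_cases hB : MeasurableSet B
  · exact (norm_map_le μ hw hB).trans
      (ENNReal.toReal_mono μ.2.ne (measure_mono (Set.subset_univ _)))
  · rw [VectorMeasure.not_measurable _ hB, norm_zero]
    exact ENNReal.toReal_nonneg

theorem summable_markov (R : ℕ → E →L[𝕜] E) (ω : ℕ → T → T)
    (hR : Summable fun i => ‖R i‖) (hω : ∀ i, Measurable (ω i)) (μ : cabv 𝕜 T E) (B : Set T) :
    Summable fun i => ‖R i ((μ : VectorMeasure T E).map (ω i) B)‖ := by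
  refine Summable.of_nonneg_of_le (fun _ => norm_nonneg _) (fun i => ?_)
    (hR.mul_right (varNorm μ))
  exact (R i).le_opNorm_of_le (norm_map_le_varNorm μ (hω i) B)

theorem summable_prod_aux {E : Type*} [NormedAddCommGroup E] {F : ℕ → ℕ → E} {u : ℕ → ℝ} {w : ℕ → ℕ → ℝ} {C : ℝ}
    (hu : Summable u) (hu0 : ∀ i, 0 ≤ u i) (hw0 : ∀ i j, 0 ≤ w i j)
    (hw : ∀ i, Summable (w i)) (hC : ∀ i, ∑' j, w i j ≤ C)
    (hF : ∀ i j, ‖F i j‖ ≤ u i * w i j) :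
    Summable fun p : ℕ × ℕ => ‖F p.1 p.2‖ := by
  have h : Summable fun p : ℕ × ℕ => u p.1 * w p.1 p.2 := by
    have h0 : (0 : ℕ × ℕ → ℝ) ≤ fun p => u p.1 * w p.1 p.2 :=
      fun p => mul_nonneg (hu0 p.1) (hw0 p.1 p.2)
    have hrow : ∀ i, Summable fun j => u i * w i j := fun i => (hw i).mul_left (u i)
    refine (summable_prod_of_nonneg h0).mpr ⟨hrow, ?_⟩
    have hle : ∀ i, ∑' j, u i * w i j ≤ u i * C := fun i => by
      rw [tsum_mul_left]
      exact mul_le_mul_of_nonneg_left (hC i) (hu0 i)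
    have hnn : ∀ i, 0 ≤ ∑' j, u i * w i j := fun i =>
      tsum_nonneg fun j => mul_nonneg (hu0 i) (hw0 i j)
    exact Summable.of_nonneg_of_le hnn hle (hu.mul_right C)
  exact Summable.of_nonneg_of_le (fun _ => norm_nonneg _) (fun p => hF p.1 p.2) h

variable [CompleteSpace E]

theorem hasSum_swap {F : ℕ → ℕ → E} {r : ℕ → E} {S : E}
    (hF : Summable fun p : ℕ × ℕ => ‖F p.1 p.2‖) (hrow : ∀ i, HasSum (F i) (r i))
    (hS : HasSum r S) : HasSum (fun j => ∑' i, F i j) S := by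
  have hsum : Summable fun p : ℕ × ℕ => F p.1 p.2 := hF.of_norm
  have h1 : S = ∑' p : ℕ × ℕ, F p.1 p.2 := hS.unique (hsum.hasSum.prod_fiberwise hrow)
  have hswap : Summable fun p : ℕ × ℕ => F p.2 p.1 := hsum.prod_symm
  have h2 : HasSum (fun p : ℕ × ℕ => F p.2 p.1) S := by
    rw [h1]
    exact (Equiv.prodComm ℕ ℕ).hasSum_iff.mpr hsum.hasSum
  exact h2.prod_fiberwise fun j => (hswap.prod_factor j).hasSum

theorem hasSum_markov (R : ℕ → E →L[𝕜] E) (ω : ℕ → T → T)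
    (hR : Summable fun i => ‖R i‖) (hω : ∀ i, Measurable (ω i)) (μ : cabv 𝕜 T E)
    {f : ℕ → Set T} (hf : ∀ j, MeasurableSet (f j)) (hd : Pairwise (Function.onFun Disjoint f)) :
    HasSum (fun j => ∑' i, R i ((μ : VectorMeasure T E).map (ω i) (f j)))
      (∑' i, R i ((μ : VectorMeasure T E).map (ω i) (⋃ j, f j))) := by
  have hfin : ∀ i, ∑' j, (μ : VectorMeasure T E).variation (ω i ⁻¹' f j) ≤
      (μ : VectorMeasure T E).variation Set.univ := by
    intro i
    rw [← measure_iUnion (fun j k hjk => (hd hjk).preimage _) (fun j => hω i (hf j))]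
    exact measure_mono (Set.subset_univ _)
  have hsv : ∀ i, Summable fun j =>
      ((μ : VectorMeasure T E).variation (ω i ⁻¹' f j)).toReal := fun i =>
    ENNReal.summable_toReal ((hfin i).trans_lt μ.2).ne
  have hC : ∀ i, ∑' j, ((μ : VectorMeasure T E).variation (ω i ⁻¹' f j)).toReal ≤
      varNorm μ := fun i => by
    rw [← ENNReal.tsum_toReal_eq
      (fun j => ((measure_mono (Set.subset_univ _)).trans_lt μ.2).ne)]
    exact ENNReal.toReal_mono μ.2.ne (hfin i)
  have hF : ∀ i j, ‖R i ((μ : VectorMeasure T E).map (ω i) (f j))‖ ≤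
      ‖R i‖ * ((μ : VectorMeasure T E).variation (ω i ⁻¹' f j)).toReal := fun i j =>
    (R i).le_opNorm_of_le (norm_map_le μ (hω i) (hf j))
  have hrow : ∀ i, HasSum (fun j => R i ((μ : VectorMeasure T E).map (ω i) (f j)))
      (R i ((μ : VectorMeasure T E).map (ω i) (⋃ j, f j))) := fun i =>
    (((μ : VectorMeasure T E).map (ω i)).m_iUnion hf hd).mapL (R i)
  exact hasSum_swap (F := fun i j => R i ((μ : VectorMeasure T E).map (ω i) (f j)))
    (summable_prod_aux (F := fun i j => R i ((μ : VectorMeasure T E).map (ω i) (f j)))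
      hR (fun _ => norm_nonneg _) (fun _ _ => ENNReal.toReal_nonneg) hsv hC hF) hrow
    (summable_markov R ω hR hω μ _).of_norm.hasSum

/-- The vector measure `B ↦ ∑ i, R i (μ (ω i ⁻¹' B))`; here `μ.map (ω i)` is the transported
measure `B ↦ μ (ω i ⁻¹' B)`. -/
noncomputable def markovMeasure (R : ℕ → E →L[𝕜] E) (ω : ℕ → T → T)
    (hR : Summable fun i => ‖R i‖) (hω : ∀ i, Measurable (ω i)) (μ : cabv 𝕜 T E) :
    VectorMeasure T E where
  measureOf' B := ∑' i, R i ((μ : VectorMeasure T E).map (ω i) B)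
  empty' := by simp
  not_measurable' B hB := by simp [VectorMeasure.not_measurable _ hB]
  m_iUnion' _ hf hd := hasSum_markov R ω hR hω μ hf hd

theorem markovMeasure_mem (R : ℕ → E →L[𝕜] E) (ω : ℕ → T → T)
    (hR : Summable fun i => ‖R i‖) (hω : ∀ i, Measurable (ω i)) (μ : cabv 𝕜 T E) :
    markovMeasure R ω hR hω μ ∈ cabv 𝕜 T E := by
  have hle : (markovMeasure R ω hR hω μ).variation ≤ Measure.sum fun i =>
      ‖R i‖ₑ • (μ : VectorMeasure T E).variation.map (ω i) := by
    refine VectorMeasure.variation_le_of_forall_enorm_le fun B hB => ?_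
    rw [Measure.sum_apply _ hB]
    change ‖∑' i, R i ((μ : VectorMeasure T E).map (ω i) B)‖ₑ ≤ _
    refine enorm_tsum_le_tsum_enorm.trans (ENNReal.tsum_le_tsum fun i => ?_)
    refine ((R i).le_opENorm _).trans ?_
    rw [Measure.smul_apply, smul_eq_mul, Measure.map_apply (hω i) hB,
      VectorMeasure.map_apply _ (hω i) hB]
    gcongr
    exact VectorMeasure.enorm_measure_le_variation _ _
  refine lt_of_le_of_lt (hle Set.univ) ?_
  have hval : ∀ i, (‖R i‖ₑ • (μ : VectorMeasure T E).variation.map (ω i)) Set.univ =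
      ‖R i‖ₑ * (μ : VectorMeasure T E).variation Set.univ := fun i => by
    rw [Measure.smul_apply, smul_eq_mul, Measure.map_apply (hω i) MeasurableSet.univ,
      Set.preimage_univ]
  rw [Measure.sum_apply _ MeasurableSet.univ, tsum_congr hval, ENNReal.tsum_mul_right]
  refine ENNReal.mul_lt_top (lt_top_iff_ne_top.mpr ?_) μ.2
  have hne : Summable fun i => ‖R i‖₊ := by
    rw [← NNReal.summable_coe]
    exact hR
  simpa [enorm_eq_nnnorm] using ENNReal.tsum_coe_ne_top_iff_summable.mpr hne

/-- The Markov-type operator `H(μ) = ∑ i, R i ∘ ω i (μ)` on `cabv(E)`. -/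
noncomputable def markov (R : ℕ → E →L[𝕜] E) (ω : ℕ → T → T)
    (hR : Summable fun i => ‖R i‖) (hω : ∀ i, Measurable (ω i)) (μ : cabv 𝕜 T E) :
    cabv 𝕜 T E :=
  ⟨markovMeasure R ω hR hω μ, markovMeasure_mem R ω hR hω μ⟩

end Markov

end SelfSimilar

/-! The operator `H` has a predual: `∫ f dH(μ) = ∑ i, ∫ (R i)* ∘ f ∘ ω i dμ` for continuous `f`
(`hasSum_vint_markov`). If `f` is 1-Lipschitz, the `i`-th integrand is Lipschitz with constant at
most `‖R i‖ * r i`. On measures of mass zero the integral of a `C`-Lipschitz function is at most `C`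
times the Monge-Kantorovich norm, so summation over `i` gives the factor `c`
(`normMKStar_markov_le`). Differences of elements of `A` have mass zero and `H` is additive, hence
`H` contracts `A`.

Banach's theorem then needs `A` to be a complete metric space. The supremum defining the distance is
finite because constants integrate to zero and `T` has finite diameter; it separates points because
indicators of closed sets are limits of Lipschitz functions. A Cauchy sequence in `A` is bounded in
variation, so it has a weak* limit along an ultrafilter (`exists_tendsto_vint`); this limit lies in
the weak* closed set `A`, and the Cauchy estimate passes to it for each test function.

The set `B_a(K^n, v)` is weak* closed because the variational norm is a dual norm
(`varNorm_le_of_forall_continuous`) and the total mass is read off from constant functions. It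
contains the Dirac mass with weight `v`, and `∑ R i = Id` makes `H` preserve the total mass. -/

namespace SelfSimilar

/-! ### Images of vector measures under linear maps -/

section MapRange

open VectorMeasure Filter

variable {X E F E' F' G : Type*} {mX : MeasurableSpace X}
  [NormedAddCommGroup E] [NormedSpace ℝ E] [NormedAddCommGroup F] [NormedSpace ℝ F]
  [NormedAddCommGroup E'] [NormedSpace ℝ E'] [NormedAddCommGroup F'] [NormedSpace ℝ F']
  [NormedAddCommGroup G] [NormedSpace ℝ G]

/-- The image `L ∘ μ` of a vector measure under a continuous linear map. -/
noncomputable def mapCLM (L : F →L[ℝ] F') (μ : VectorMeasure X F) : VectorMeasure X F' :=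
  μ.mapRange (L : F →ₗ[ℝ] F').toAddMonoidHom L.continuous

@[simp] theorem mapCLM_apply (L : F →L[ℝ] F') (μ : VectorMeasure X F) (s : Set X) :
    mapCLM L μ s = L (μ s) := rfl

theorem variation_mapCLM_le (L : F →L[ℝ] F') (μ : VectorMeasure X F) :
    (mapCLM L μ).variation ≤ ‖L‖ₑ • μ.variation := by
  refine variation_le_of_forall_enorm_le fun s _ => ?_
  rw [mapCLM_apply, Measure.smul_apply, smul_eq_mul]
  exact (L.le_opENorm _).trans (by gcongr; exact enorm_measure_le_variation _ _)

theorem variation_mapCLM_lt_top (L : F →L[ℝ] F') {μ : VectorMeasure X F}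
    (hμ : μ.variation Set.univ < ∞) : (mapCLM L μ).variation Set.univ < ∞ :=
  (variation_mapCLM_le L μ Set.univ).trans_lt (ENNReal.mul_lt_top (by simp) hμ)

omit [NormedSpace ℝ E'] in
theorem integrable_mapCLM (L : F →L[ℝ] F') {μ : VectorMeasure X F} {f : X → E'}
    (hf : μ.Integrable f) : (mapCLM L μ).Integrable f :=
  MeasureTheory.Integrable.of_measure_le_smul (by simp) (variation_mapCLM_le L μ) hf

theorem integral_indicator_const [CompleteSpace G] (B : E →L[ℝ] F →L[ℝ] G)
    (μ : VectorMeasure X F) {s : Set X} (hs : MeasurableSet s) (hμs : μ.variation s ≠ ∞) (x : E) :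
    μ.integral (s.indicator fun _ => x) B = B x (μ s) := by
  rw [VectorMeasure.integral, setToFun_indicator_const _ hs hμs]
  rfl

/-- Change of variables for the image of a vector measure under a linear map `L` whose transpose
with respect to the pairings `B` and `B'` is `L'`. -/
theorem integral_mapCLM [CompleteSpace G] (B : E →L[ℝ] F →L[ℝ] G) (B' : E' →L[ℝ] F' →L[ℝ] G)
    (L : F →L[ℝ] F') (L' : E' →L[ℝ] E) (hL : ∀ x y, B' x (L y) = B (L' x) y)
    (μ : VectorMeasure X F) {f : X → E'} (hf : μ.Integrable f) :
    (mapCLM L μ).integral f B' = μ.integral (fun x => L' (f x)) B := by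
  have hle := variation_mapCLM_le L μ
  have hac : (mapCLM L μ).variation ≪ μ.variation := Measure.absolutelyContinuous_of_le_smul hle
  refine MeasureTheory.Integrable.induction (μ := μ.variation)
    (fun f => (mapCLM L μ).integral f B' = μ.integral (fun x => L' (f x)) B) ?_ ?_ ?_ ?_ hf
  · intro c s hs hμs
    have h1 : (fun x => L' (s.indicator (fun _ => c) x)) = s.indicator fun _ => L' c := by
      ext x
      by_cases hx : x ∈ s <;> simp [hx]
    rw [h1, integral_indicator_const _ _ hs hμs.ne, integral_indicator_const _ _ hs, mapCLM_apply,
      hL]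
    exact ((hle s).trans_lt (ENNReal.mul_lt_top (by simp) hμs)).ne
  · intro f g _ hf hg hPf hPg
    have h1 : (fun x => L' ((f + g) x)) = (fun x => L' (f x)) + fun x => L' (g x) := by
      ext x
      simp
    rw [h1, VectorMeasure.integral_add (integrable_mapCLM L hf) (integrable_mapCLM L hg),
      VectorMeasure.integral_add (L'.integrable_comp hf) (L'.integrable_comp hg), hPf, hPg]
  -- Both sides are continuous in `f` for the L¹ norm of `|μ|`: the variation of `L ∘ μ` is at most
  -- `‖L‖ |μ|`, and `L'` is bounded.
  · refine isClosed_eq (continuous_iff_continuousAt.mpr fun f => ?_)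
      (continuous_iff_continuousAt.mpr fun f => ?_)
    · refine tendsto_integral_of_L1' _ ((Lp.aestronglyMeasurable f).mono_ac hac)
        (Eventually.of_forall fun g => integrable_mapCLM L (L1.integrable_coeFn g)) ?_
      have h0 := (Lp.tendsto_Lp_iff_tendsto_eLpNorm' id f).mp (tendsto_id (x := 𝓝 f))
      have h1 := ENNReal.Tendsto.const_mul (a := ‖L‖ₑ) h0 (Or.inr (by simp))
      rw [mul_zero] at h1
      refine tendsto_of_tendsto_of_tendsto_of_le_of_le tendsto_const_nhds h1
        (fun _ => zero_le) fun g => ?_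
      refine (eLpNorm_mono_measure _ hle).trans ?_
      simp [eLpNorm_one_smul_measure]
    · refine tendsto_integral_of_L1' _
        (L'.continuous.comp_aestronglyMeasurable (Lp.aestronglyMeasurable f))
        (Eventually.of_forall fun g => L'.integrable_comp (L1.integrable_coeFn g)) ?_
      have h0 := (Lp.tendsto_Lp_iff_tendsto_eLpNorm' id f).mp (tendsto_id (x := 𝓝 f))
      have h1 := ENNReal.Tendsto.const_mul (a := ‖L'‖ₑ) h0 (Or.inr (by simp))
      rw [mul_zero] at h1
      refine tendsto_of_tendsto_of_tendsto_of_le_of_le tendsto_const_nhds h1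
        (fun _ => zero_le) fun g => ?_
      simp only [eLpNorm_one_eq_lintegral_enorm, Pi.sub_apply, id]
      rw [← lintegral_const_mul' _ _ (by simp)]
      refine lintegral_mono fun x => ?_
      rw [← map_sub]
      exact L'.le_opENorm _
  · intro f g hfg _ hPf
    rw [← VectorMeasure.integral_congr_ae (hac.ae_le hfg), hPf]
    refine VectorMeasure.integral_congr_ae ?_
    filter_upwards [hfg] with x hx
    rw [hx]

end MapRange

/-! ### Elementary properties of the integral -/

section Integral

open Filter

variable {𝕜 : Type*} [RCLike 𝕜] {T : Type*} [MeasurableSpace T]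
  {E : Type*} [NormedAddCommGroup E] [InnerProductSpace 𝕜 E] [NormedSpace ℝ E]
  [IsScalarTower ℝ 𝕜 E]

omit [NormedSpace ℝ E] [IsScalarTower ℝ 𝕜 E] in
theorem isFiniteMeasure_variation (μ : cabv 𝕜 T E) :
    IsFiniteMeasure (μ : VectorMeasure T E).variation := ⟨μ.2⟩

@[simp] theorem pairing_apply (x y : E) : pairing 𝕜 E x y = inner 𝕜 y x := rfl

theorem norm_pairing_le : ‖pairing 𝕜 E‖ ≤ 1 :=
  LinearMap.mkContinuous₂_norm_le _ zero_le_one _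

theorem norm_vint_le_integral (f : T → E) (μ : cabv 𝕜 T E) :
    ‖vint f μ‖ ≤ ∫ x, ‖f x‖ ∂(μ : VectorMeasure T E).variation :=
  VectorMeasure.norm_integral_le_integral_norm.trans <|
    mul_le_of_le_one_left (integral_nonneg fun _ => norm_nonneg _) norm_pairing_le

theorem norm_vint_le {f : T → E} {C : ℝ} (hC : ∀ x, ‖f x‖ ≤ C) (μ : cabv 𝕜 T E) :
    ‖vint f μ‖ ≤ C * varNorm μ := by
  have := isFiniteMeasure_variation μ
  refine (norm_vint_le_integral f μ).trans ?_
  refine (integral_mono_of_nonneg (ae_of_all _ fun _ => norm_nonneg _) (integrable_const C)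
    (ae_of_all _ hC)).trans_eq ?_
  simp [varNorm, Measure.real, mul_comm]

theorem vint_const (x : E) (μ : cabv 𝕜 T E) :
    vint (fun _ => x) μ = inner 𝕜 ((μ : VectorMeasure T E) Set.univ) x := by
  have := isFiniteMeasure_variation μ
  exact VectorMeasure.integral_const x

theorem vint_indicator_const {s : Set T} (hs : MeasurableSet s) (x : E) (μ : cabv 𝕜 T E) :
    vint (s.indicator fun _ => x) μ = inner 𝕜 ((μ : VectorMeasure T E) s) x := by
  have := isFiniteMeasure_variation μ
  exact integral_indicator_const _ _ hs (measure_ne_top _ _) x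

theorem vint_neg (f : T → E) (μ : cabv 𝕜 T E) : vint f (-μ) = -vint f μ :=
  VectorMeasure.integral_neg_vectorMeasure

variable [TopologicalSpace T] [CompactSpace T] [BorelSpace T] [ProperSpace E]

omit [NormedSpace ℝ E] [IsScalarTower ℝ 𝕜 E] [InnerProductSpace 𝕜 E] in
theorem integrable_of_continuous {f : T → E} (hf : Continuous f) (m : Measure T)
    [IsFiniteMeasure m] : Integrable f m := by
  obtain ⟨C, hC⟩ := isCompact_univ.exists_bound_of_continuousOn hf.continuousOn
  borelize E
  exact Integrable.of_bound hf.measurable.aestronglyMeasurable C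
    (ae_of_all _ fun x => hC x (Set.mem_univ x))

omit [NormedSpace ℝ E] [IsScalarTower ℝ 𝕜 E] in
theorem integrable_variation {f : T → E} (hf : Continuous f) (μ : cabv 𝕜 T E) :
    (μ : VectorMeasure T E).Integrable f :=
  have := isFiniteMeasure_variation μ
  integrable_of_continuous hf _

theorem vint_sub_right {f : T → E} (hf : Continuous f) (μ ν : cabv 𝕜 T E) :
    vint f (μ - ν) = vint f μ - vint f ν :=
  VectorMeasure.integral_sub_vectorMeasure (integrable_variation hf μ) (integrable_variation hf ν)

theorem vint_add_right {f : T → E} (hf : Continuous f) (μ ν : cabv 𝕜 T E) :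
    vint f (μ + ν) = vint f μ + vint f ν :=
  VectorMeasure.integral_add_vectorMeasure (integrable_variation hf μ) (integrable_variation hf ν)

omit [TopologicalSpace T] [CompactSpace T] [BorelSpace T] [ProperSpace E] in
theorem vint_zero (f : T → E) : vint f (0 : cabv 𝕜 T E) = 0 :=
  VectorMeasure.integral_zero_vectorMeasure

theorem vint_sum {ι : Type*} {f : T → E} (hf : Continuous f) (s : Finset ι)
    (μ : ι → cabv 𝕜 T E) : vint f (∑ i ∈ s, μ i) = ∑ i ∈ s, vint f (μ i) := by
  classical
  induction s using Finset.induction_on with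
  | empty => simp only [Finset.sum_empty, vint_zero]
  | insert i s hi ih => rw [Finset.sum_insert hi, Finset.sum_insert hi, vint_add_right hf, ih]

theorem vint_sub_left {f g : T → E} (hf : Continuous f) (hg : Continuous g) (μ : cabv 𝕜 T E) :
    vint (fun x => f x - g x) μ = vint f μ - vint g μ :=
  VectorMeasure.integral_fun_sub (integrable_variation hf μ) (integrable_variation hg μ)

end Integral

/-! ### The Markov-type operator and its predual -/

section Markov

open Filter VectorMeasure

variable {𝕜 : Type*} [RCLike 𝕜] {T : Type*} [MeasurableSpace T]
  {E : Type*} [NormedAddCommGroup E]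

/-- Each transported measure has mass at most `|μ|(T)`, so the tail of the series is controlled by
the tail of `∑ ‖R i‖`. The case `N = 0` bounds the norm of `H(μ)`; `N → ∞` allows integration term
by term. The summands `ν i` are specified by their values only, so that both 𝕜-linear and ℝ-linear
constructions fit. -/
theorem variation_markov_sub_sum_le [NormedSpace 𝕜 E] [CompleteSpace E]
    (R : ℕ → E →L[𝕜] E) (ω : ℕ → T → T)
    (hR : Summable fun i => ‖R i‖) (hω : ∀ i, Measurable (ω i)) (μ : cabv 𝕜 T E)
    (ν : ℕ → VectorMeasure T E)
    (hν : ∀ i s, ν i s = R i ((μ : VectorMeasure T E).map (ω i) s)) (N : ℕ) :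
    ((markov R ω hR hω μ : VectorMeasure T E) - ∑ i ∈ Finset.range N, ν i).variation Set.univ ≤
      (∑' i, ‖R (i + N)‖ₑ) * (μ : VectorMeasure T E).variation Set.univ := by
  have hle : ((markov R ω hR hω μ : VectorMeasure T E) -
      ∑ i ∈ Finset.range N, ν i).variation ≤ Measure.sum fun i =>
        ‖R (i + N)‖ₑ • (μ : VectorMeasure T E).variation.map (ω (i + N)) := by
    refine variation_le_of_forall_enorm_le fun B hB => ?_
    have hval : ((markov R ω hR hω μ : VectorMeasure T E) - ∑ i ∈ Finset.range N, ν i) B =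
        ∑' i, R (i + N) ((μ : VectorMeasure T E).map (ω (i + N)) B) := by
      have h1 := (summable_markov R ω hR hω μ B).of_norm.sum_add_tsum_nat_add N
      have h2 : (∑ i ∈ Finset.range N, ν i) B =
          ∑ i ∈ Finset.range N, R i ((μ : VectorMeasure T E).map (ω i) B) := by
        simp [hν]
      rw [_root_.sub_apply, h2, sub_eq_iff_eq_add', h1]
      rfl
    rw [hval, Measure.sum_apply _ hB]
    refine enorm_tsum_le_tsum_enorm.trans (ENNReal.tsum_le_tsum fun i => ?_)
    refine ((R (i + N)).le_opENorm _).trans ?_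
    rw [Measure.smul_apply, smul_eq_mul, Measure.map_apply (hω _) hB,
      VectorMeasure.map_apply _ (hω _) hB]
    gcongr
    exact enorm_measure_le_variation _ _
  refine (hle Set.univ).trans_eq ?_
  rw [Measure.sum_apply _ MeasurableSet.univ, ← ENNReal.tsum_mul_right]
  refine tsum_congr fun i => ?_
  rw [Measure.smul_apply, smul_eq_mul, Measure.map_apply (hω _) MeasurableSet.univ,
    Set.preimage_univ]

theorem tsum_enorm_eq {F : Type*} [NormedAddCommGroup F] {R : ℕ → F}
    (hR : Summable fun i => ‖R i‖) : ∑' i, ‖R i‖ₑ = ENNReal.ofReal (∑' i, ‖R i‖) := by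
  rw [ENNReal.ofReal_tsum_of_nonneg (fun _ => norm_nonneg _) hR]
  simp

theorem varNorm_markov_le [NormedSpace 𝕜 E] [CompleteSpace E]
    (R : ℕ → E →L[𝕜] E) (ω : ℕ → T → T)
    (hR : Summable fun i => ‖R i‖) (hω : ∀ i, Measurable (ω i)) (μ : cabv 𝕜 T E) :
    varNorm (markov R ω hR hω μ) ≤ (∑' i, ‖R i‖) * varNorm μ := by
  have h := variation_markov_sub_sum_le R ω hR hω μ
    (fun i => ((μ : VectorMeasure T E).map (ω i)).mapRange (R i : E →ₗ[𝕜] E).toAddMonoidHom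
      (R i).continuous) (fun _ _ => rfl) 0
  simp only [Finset.range_zero, Finset.sum_empty, sub_zero, add_zero, tsum_enorm_eq hR] at h
  have h1 := ENNReal.toReal_mono (ENNReal.mul_ne_top (by simp) μ.2.ne) h
  rwa [ENNReal.toReal_mul, ENNReal.toReal_ofReal (tsum_nonneg fun _ => norm_nonneg _)] at h1

theorem markov_univ [NormedSpace 𝕜 E] [CompleteSpace E]
    (R : ℕ → E →L[𝕜] E) (ω : ℕ → T → T)
    (hR : Summable fun i => ‖R i‖) (hω : ∀ i, Measurable (ω i)) (μ : cabv 𝕜 T E) :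
    (markov R ω hR hω μ : VectorMeasure T E) Set.univ =
      (∑' i, R i) ((μ : VectorMeasure T E) Set.univ) := by
  change ∑' i, R i ((μ : VectorMeasure T E).map (ω i) Set.univ) = _
  have h := (ContinuousLinearMap.apply 𝕜 E ((μ : VectorMeasure T E) Set.univ)).map_tsum hR.of_norm
  simp only [ContinuousLinearMap.apply_apply] at h
  rw [h]
  refine tsum_congr fun i => ?_
  rw [VectorMeasure.map_apply _ (hω i) MeasurableSet.univ, Set.preimage_univ]

theorem markov_sub [NormedSpace 𝕜 E] [CompleteSpace E]
    (R : ℕ → E →L[𝕜] E) (ω : ℕ → T → T)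
    (hR : Summable fun i => ‖R i‖) (hω : ∀ i, Measurable (ω i)) (μ ν : cabv 𝕜 T E) :
    markov R ω hR hω (μ - ν) = markov R ω hR hω μ - markov R ω hR hω ν := by
  refine Subtype.ext (VectorMeasure.ext fun B hB => ?_)
  change ∑' i, R i ((μ - ν : VectorMeasure T E).map (ω i) B) =
    ∑' i, R i ((μ : VectorMeasure T E).map (ω i) B) -
      ∑' i, R i ((ν : VectorMeasure T E).map (ω i) B)
  rw [← (summable_markov R ω hR hω μ B).of_norm.tsum_sub (summable_markov R ω hR hω ν B).of_norm]
  refine tsum_congr fun i => ?_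
  simp [VectorMeasure.map_apply _ (hω i) hB]

variable [InnerProductSpace 𝕜 E] [NormedSpace ℝ E] [IsScalarTower ℝ 𝕜 E]
  [TopologicalSpace T] [CompactSpace T] [BorelSpace T] [ProperSpace E]

/-- The operator `f ↦ ∑ i, (R i)* ∘ f ∘ ω i` is the predual of the Markov-type operator. -/
theorem hasSum_vint_markov (R : ℕ → E →L[𝕜] E) (ω : ℕ → T → T)
    (hR : Summable fun i => ‖R i‖) (hω : ∀ i, Measurable (ω i)) (hωc : ∀ i, Continuous (ω i))
    (μ : cabv 𝕜 T E) {f : T → E} (hf : Continuous f)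
    (hs : Summable fun i => ‖vint (fun x => (R i).adjoint (f (ω i x))) μ‖) :
    HasSum (fun i => vint (fun x => (R i).adjoint (f (ω i x))) μ)
      (vint f (markov R ω hR hω μ)) := by
  have := isFiniteMeasure_variation μ
  obtain ⟨C, hC⟩ := isCompact_univ.exists_bound_of_continuousOn hf.continuousOn
  let ν : ℕ → VectorMeasure T E := fun i =>
    mapCLM ((R i).restrictScalars ℝ) ((μ : VectorMeasure T E).map (ω i))
  have hfin : ∀ i, ((μ : VectorMeasure T E).map (ω i)).variation Set.univ < ∞ := fun i => by
    refine (variation_map_le Set.univ).trans_lt ?_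
    rw [Measure.map_apply (hω i) MeasurableSet.univ, Set.preimage_univ]
    exact μ.2
  let ν' : ℕ → cabv 𝕜 T E := fun i => ⟨ν i, variation_mapCLM_lt_top _ (hfin i)⟩
  -- Moving `R i` across the pairing produces its adjoint; change of variables along `ω i` produces
  -- the composition.
  have hint : ∀ i, vint f (ν' i) = vint (fun x => (R i).adjoint (f (ω i x))) μ := fun i => by
    have hL : ∀ x y : E, pairing 𝕜 E x ((R i).restrictScalars ℝ y) =
        pairing 𝕜 E ((R i).adjoint.restrictScalars ℝ x) y := fun x y => by
      simp [ContinuousLinearMap.adjoint_inner_right]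
    have : IsFiniteMeasure ((μ : VectorMeasure T E).map (ω i)).variation := ⟨hfin i⟩
    have h1 := integral_mapCLM (pairing 𝕜 E) (pairing 𝕜 E) _ _ hL
      ((μ : VectorMeasure T E).map (ω i)) (integrable_of_continuous hf _)
    refine h1.trans ?_
    have hc : Continuous fun x => (R i).adjoint (f x) := (R i).adjoint.continuous.comp hf
    exact VectorMeasure.integral_map (hω i)
      (integrable_of_continuous hc _).aestronglyMeasurable
      (integrable_of_continuous (hc.comp (hωc i)) _)
  refine (hs.of_norm.hasSum_iff_tendsto_nat).mpr ?_
  have hν' : ∀ N, vint f (markov R ω hR hω μ - ∑ i ∈ Finset.range N, ν' i) =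
      vint f (markov R ω hR hω μ) -
        ∑ i ∈ Finset.range N, vint (fun x => (R i).adjoint (f (ω i x))) μ := fun N => by
    rw [vint_sub_right hf]
    congr 1
    rw [← Finset.sum_congr rfl fun i _ => hint i]
    exact vint_sum hf _ _
  -- The error of a partial sum is the integral of `f` against the tail measure. The bound `C` could
  -- be negative if `T` were empty, hence `|C|`.
  have hdiff : ∀ N, ‖(∑ i ∈ Finset.range N, vint (fun x => (R i).adjoint (f (ω i x))) μ) -
      vint f (markov R ω hR hω μ)‖ ≤
      |C| * ((∑' i, ‖R (i + N)‖ₑ) * (μ : VectorMeasure T E).variation Set.univ).toReal := fun N => by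
    rw [norm_sub_rev, ← hν']
    refine (norm_vint_le (fun x => (hC x (Set.mem_univ x)).trans (le_abs_self C)) _).trans ?_
    have hfin' : ∑' i, ‖R (i + N)‖ₑ ≠ ∞ := by
      rw [tsum_enorm_eq ((summable_nat_add_iff (f := fun i => ‖R i‖) N).mpr hR)]
      exact ENNReal.ofReal_ne_top
    have h := variation_markov_sub_sum_le R ω hR hω μ ν (fun _ _ => rfl) N
    have h2 : ((∑ i ∈ Finset.range N, ν' i : cabv 𝕜 T E) : VectorMeasure T E) =
        ∑ i ∈ Finset.range N, ν i := by
      simp [ν']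
    rw [← h2] at h
    exact mul_le_mul_of_nonneg_left (ENNReal.toReal_mono (ENNReal.mul_ne_top hfin' μ.2.ne) h)
      (abs_nonneg C)
  refine tendsto_iff_norm_sub_tendsto_zero.mpr
    (squeeze_zero (fun _ => norm_nonneg _) hdiff ?_)
  have h0 : Tendsto (fun N => ∑' i, ‖R (i + N)‖ₑ) atTop (𝓝 0) := by
    refine ENNReal.tendsto_sum_nat_add (fun i => ‖R i‖ₑ) ?_
    rw [tsum_enorm_eq hR]
    exact ENNReal.ofReal_ne_top
  have h1 := ENNReal.Tendsto.mul_const (b := (μ : VectorMeasure T E).variation Set.univ) h0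
    (Or.inr μ.2.ne)
  rw [zero_mul] at h1
  have h2 := ((ENNReal.tendsto_toReal ENNReal.zero_ne_top).comp h1).const_mul |C|
  simpa using h2

end Markov

/-! ### Lipschitz constants -/

theorem lipConst_nonneg {T Y : Type*} [MetricSpace T] [MetricSpace Y] (f : T → Y) :
    0 ≤ lipConst f :=
  Real.sSup_nonneg (by rintro r ⟨x, y, _, rfl⟩; positivity)

/-- The real `sSup` of an unbounded set is `0`; some Lipschitz bound `K` is needed for `lipConst f`
to be a genuine supremum. -/
theorem dist_le_lipConst_mul {T Y : Type*} [MetricSpace T] [MetricSpace Y] {f : T → Y}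
    {K : NNReal} (hf : LipschitzWith K f) (x y : T) :
    dist (f x) (f y) ≤ lipConst f * dist x y := by
  rcases eq_or_ne x y with rfl | hxy
  · simp
  · rw [← div_le_iff₀ (dist_pos.mpr hxy)]
    refine le_csSup ⟨K, ?_⟩ ⟨x, y, hxy, rfl⟩
    rintro r ⟨x, y, h, rfl⟩
    rw [div_le_iff₀ (dist_pos.mpr h)]
    exact hf.dist_le_mul x y

/-! ### Truncation to the unit ball -/

section RadialRetraction

variable {E : Type*} [NormedAddCommGroup E] [NormedSpace ℝ E]

/-- The radial retraction of a normed space onto its closed unit ball. -/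
noncomputable def radialRetraction (x : E) : E := (max 1 ‖x‖)⁻¹ • x

theorem continuous_radialRetraction : Continuous (radialRetraction : E → E) := by
  refine Continuous.smul (Continuous.inv₀ (by fun_prop) fun x => ?_) continuous_id
  exact (zero_lt_one.trans_le (le_max_left _ _)).ne'

theorem norm_radialRetraction_le (x : E) : ‖radialRetraction x‖ ≤ 1 := by
  have h : 0 < max 1 ‖x‖ := zero_lt_one.trans_le (le_max_left _ _)
  rw [radialRetraction, norm_smul, norm_inv, Real.norm_of_nonneg h.le, inv_mul_le_iff₀ h, mul_one]
  exact le_max_right _ _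

/-- The retraction moves `x` by `max 0 (‖x‖ - 1)`, which is at most the distance from `x` to any
point of the ball. Truncating an approximant of a function bounded by 1 thus at most doubles the
error. -/
theorem norm_radialRetraction_sub_le (x : E) {y : E} (hy : ‖y‖ ≤ 1) :
    ‖radialRetraction x - y‖ ≤ 2 * ‖x - y‖ := by
  have h : 0 < max 1 ‖x‖ := zero_lt_one.trans_le (le_max_left _ _)
  have h1 : ‖radialRetraction x - x‖ ≤ ‖x - y‖ := by
    have h2 : radialRetraction x - x = ((max 1 ‖x‖)⁻¹ - 1) • x := by
      rw [sub_smul, one_smul, radialRetraction]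
    have h3 : (max 1 ‖x‖)⁻¹ ≤ 1 := inv_le_one_of_one_le₀ (le_max_left _ _)
    rw [h2, norm_smul, Real.norm_of_nonpos (by linarith)]
    rcases le_total ‖x‖ 1 with hx | hx
    · simp [max_eq_left hx]
    · have h4 : -((max 1 ‖x‖)⁻¹ - 1) * ‖x‖ = ‖x‖ - 1 := by
        rw [max_eq_right hx]
        field_simp
        ring
      rw [h4]
      linarith [norm_sub_norm_le x y]
  calc ‖radialRetraction x - y‖ ≤ ‖radialRetraction x - x‖ + ‖x - y‖ :=
        norm_sub_le_norm_sub_add_norm_sub _ _ _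
    _ ≤ 2 * ‖x - y‖ := by linarith

end RadialRetraction

/-! ### The Monge-Kantorovich norm and the dual norm -/

section NormMK

open Filter VectorMeasure

variable {𝕜 : Type*} [RCLike 𝕜] {T : Type*} [MeasurableSpace T] [MetricSpace T] [CompactSpace T]
  [BorelSpace T] {E : Type*} [NormedAddCommGroup E] [InnerProductSpace 𝕜 E] [NormedSpace ℝ E]
  [IsScalarTower ℝ 𝕜 E]

omit [CompactSpace T] [BorelSpace T] in
theorem normMKStar_nonneg (μ : cabv 𝕜 T E) : 0 ≤ normMKStar μ :=
  Real.sSup_nonneg (by rintro r ⟨f, _, rfl⟩; exact norm_nonneg _)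

omit [CompactSpace T] [BorelSpace T] in
theorem normMKStar_le {μ : cabv 𝕜 T E} {b : ℝ}
    (h : ∀ f : T → E, LipschitzWith 1 f → ‖vint f μ‖ ≤ b) : normMKStar μ ≤ b :=
  csSup_le ⟨_, fun _ => 0, LipschitzWith.const' _, rfl⟩ (by rintro r ⟨f, hf, rfl⟩; exact h f hf)

omit [CompactSpace T] [BorelSpace T] in
theorem normMKStar_neg (μ : cabv 𝕜 T E) : normMKStar (-μ) = normMKStar μ := by
  simp [normMKStar, vint_neg]

variable [ProperSpace E]

/-- The point is that the supremum is finite: mass zero allows `f` to be replaced by `f - f x₀`,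
which is bounded by the diameter of `T`. -/
theorem norm_vint_le_normMKStar_of_lipschitz_one [Nonempty T] {μ : cabv 𝕜 T E}
    (hμ : (μ : VectorMeasure T E) Set.univ = 0) {f : T → E} (hf : LipschitzWith 1 f) :
    ‖vint f μ‖ ≤ normMKStar μ := by
  refine le_csSup ⟨Metric.diam (Set.univ : Set T) * varNorm μ, ?_⟩ ⟨f, hf, rfl⟩
  rintro r ⟨f, hf, rfl⟩
  let x₀ : T := Classical.arbitrary T
  have h1 : vint f μ = vint (fun x => f x - f x₀) μ := by
    rw [vint_sub_left hf.continuous continuous_const, vint_const, hμ, inner_zero_left, sub_zero]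
  rw [h1]
  refine norm_vint_le (fun x => ?_) μ
  rw [← dist_eq_norm]
  refine (hf.dist_le_mul x x₀).trans ?_
  simpa using Metric.dist_le_diam_of_mem isCompact_univ.isBounded (Set.mem_univ x)
    (Set.mem_univ x₀)

theorem norm_vint_le_mul_normMKStar [Nonempty T] {μ : cabv 𝕜 T E}
    (hμ : (μ : VectorMeasure T E) Set.univ = 0) {f : T → E} {C : ℝ} (hC : 0 ≤ C)
    (hf : ∀ x y, dist (f x) (f y) ≤ C * dist x y) :
    ‖vint f μ‖ ≤ C * normMKStar μ := by
  rcases hC.eq_or_lt with rfl | hC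
  -- Rescaling by `C⁻¹` fails for `C = 0`, but then `f` is constant and integrates to zero.
  · let x₀ : T := Classical.arbitrary T
    have h1 : f = fun _ => f x₀ := by
      ext x
      simpa using hf x x₀
    rw [h1, vint_const, hμ]
    simp
  · have h1 : f = fun x => C • (C⁻¹ • f x) := by
      ext x
      rw [smul_inv_smul₀ hC.ne']
    have h2 : LipschitzWith 1 fun x => C⁻¹ • f x := by
      refine LipschitzWith.of_dist_le_mul fun x y => ?_
      rw [dist_smul₀, Real.norm_of_nonneg (inv_nonneg.mpr hC.le), inv_mul_le_iff₀ hC]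
      simpa using hf x y
    have h3 : vint f μ = C • vint (fun x => C⁻¹ • f x) μ := by
      conv_lhs => rw [h1]
      exact VectorMeasure.integral_fun_smul _ _ C _
    rw [h3, norm_smul, Real.norm_of_nonneg hC.le]
    exact mul_le_mul_of_nonneg_left (norm_vint_le_normMKStar_of_lipschitz_one hμ h2) hC.le

theorem normMKStar_add_le [Nonempty T] {μ ν : cabv 𝕜 T E}
    (hμ : (μ : VectorMeasure T E) Set.univ = 0) (hν : (ν : VectorMeasure T E) Set.univ = 0) :
    normMKStar (μ + ν) ≤ normMKStar μ + normMKStar ν := by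
  refine normMKStar_le fun f hf => ?_
  rw [vint_add_right hf.continuous]
  exact (norm_add_le _ _).trans (add_le_add (norm_vint_le_normMKStar_of_lipschitz_one hμ hf)
    (norm_vint_le_normMKStar_of_lipschitz_one hν hf))

/-- A vector measure of mass zero which vanishes on Lipschitz functions is zero. -/
theorem eq_zero_of_normMKStar_eq_zero [Nonempty T] {μ : cabv 𝕜 T E}
    (hμ : (μ : VectorMeasure T E) Set.univ = 0) (h : normMKStar μ = 0) : μ = 0 := by
  have := isFiniteMeasure_variation μ
  -- Closed sets form a π-system generating the Borel sets, so it suffices that `μ` vanish on them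
  -- and on the whole space.
  refine Subtype.ext (VectorMeasure.ext_of_generateFrom {s | IsClosed s} (fun s hs => ?_)
    (BorelSpace.measurable_eq.trans borel_eq_generateFrom_isClosed) isPiSystem_isClosed (by simpa))
  refine ext_inner_right 𝕜 fun x => ?_
  have hδ : ∀ n : ℕ, (0 : ℝ) < 1 / (n + 1) := fun n => by positivity
  -- Lipschitz functions converging boundedly to the indicator of `s` times `x`; dominated
  -- convergence gives that the pairing of `μ s` with `x` is zero.
  let F : ℕ → T → E := fun n t => (thickenedIndicator (hδ n) s t : ℝ) • x
  have hlip : ∀ n : ℕ, LipschitzWith ((1 / ((n : ℝ) + 1)).toNNReal⁻¹ * ‖x‖₊) (F n) := fun n => by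
    refine LipschitzWith.of_dist_le_mul fun a b => ?_
    rw [dist_eq_norm, ← sub_smul, norm_smul, NNReal.coe_mul, coe_nnnorm, mul_right_comm]
    refine mul_le_mul_of_nonneg_right ?_ (norm_nonneg x)
    exact (lipschitzWith_thickenedIndicator (hδ n) s).dist_le_mul a b
  have hzero : ∀ n, vint (F n) μ = 0 := fun n => by
    have h1 := norm_vint_le_mul_normMKStar hμ (NNReal.coe_nonneg _)
      fun a b => (hlip n).dist_le_mul a b
    rw [h, mul_zero] at h1
    exact norm_le_zero_iff.mp h1
  have hlim : Tendsto (fun n => vint (F n) μ) atTop (𝓝 (vint (s.indicator fun _ => x) μ)) := by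
    refine VectorMeasure.tendsto_integral_filter_of_norm_le_const
      (Eventually.of_forall fun n =>
        (integrable_variation (hlip n).continuous μ).aestronglyMeasurable)
      ⟨‖x‖, Eventually.of_forall fun n => ae_of_all _ fun t => ?_⟩ (ae_of_all _ fun t => ?_)
    · rw [norm_smul]
      refine mul_le_of_le_one_left (norm_nonneg x) ?_
      simpa using thickenedIndicator_le_one (hδ n) s t
    · have h1 := tendsto_pi_nhds.mp (thickenedIndicator_tendsto_indicator_closure hδ
        tendsto_one_div_add_atTop_nhds_zero_nat s) t
      have h2 := ((NNReal.continuous_coe.tendsto _).comp h1).smul_const x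
      rw [IsClosed.closure_eq hs] at h2
      by_cases ht : t ∈ s <;> simpa [F, ht] using h2
  simp only [hzero] at hlim
  rw [vint_indicator_const (IsClosed.measurableSet hs)] at hlim
  simpa using (tendsto_nhds_unique hlim tendsto_const_nhds)

/-- The Markov-type operator is a contraction of ratio `∑ i, ‖R i‖ * r i` on the measures of
mass zero. -/
theorem normMKStar_markov_le [Nonempty T] (R : ℕ → E →L[𝕜] E) (ω : ℕ → T → T)
    (hR : Summable fun i => ‖R i‖) (hω : ∀ i, Measurable (ω i))
    (hωl : ∀ i, ∃ K, LipschitzWith K (ω i))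
    (hs : Summable fun i => ‖R i‖ * lipConst (ω i)) {μ : cabv 𝕜 T E}
    (hμ : (μ : VectorMeasure T E) Set.univ = 0) :
    normMKStar (markov R ω hR hω μ) ≤ (∑' i, ‖R i‖ * lipConst (ω i)) * normMKStar μ := by
  refine normMKStar_le fun f hf => ?_
  have hle : ∀ i, ‖vint (fun x => (R i).adjoint (f (ω i x))) μ‖ ≤
      ‖R i‖ * lipConst (ω i) * normMKStar μ := fun i => by
    obtain ⟨K, hK⟩ := hωl i
    refine norm_vint_le_mul_normMKStar hμ (mul_nonneg (norm_nonneg _) (lipConst_nonneg _))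
      fun x y => ?_
    rw [dist_eq_norm, ← map_sub, mul_assoc]
    refine ((R i).adjoint.le_opNorm _).trans ?_
    rw [LinearIsometryEquiv.norm_map, ← dist_eq_norm]
    refine mul_le_mul_of_nonneg_left ?_ (norm_nonneg _)
    refine (hf.dist_le_mul _ _).trans ?_
    simpa using dist_le_lipConst_mul hK x y
  have hs' := hs.mul_right (normMKStar μ)
  have hsum : Summable fun i => ‖vint (fun x => (R i).adjoint (f (ω i x))) μ‖ :=
    Summable.of_nonneg_of_le (fun _ => norm_nonneg _) hle hs'
  rw [← (hasSum_vint_markov R ω hR hω (fun i => (hωl i).choose_spec.continuous) μ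
    hf.continuous hsum).tsum_eq, ← tsum_mul_right]
  exact (norm_tsum_le_tsum_norm hsum).trans (hsum.tsum_le_tsum hle hs')

/-- The variational norm is the dual norm on the continuous functions. -/
theorem varNorm_le_of_forall_continuous {μ : cabv 𝕜 T E} {a : ℝ}
    (h : ∀ f : T → E, Continuous f → (∀ x, ‖f x‖ ≤ 1) → ‖vint f μ‖ ≤ a) : varNorm μ ≤ a := by
  have := isFiniteMeasure_variation μ
  refine le_of_forall_pos_le_add fun ε hε => ?_
  -- Half of `ε` is spent on a finite disjoint family nearly attaining the variation, half on
  -- replacing a simple function by a continuous one.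
  obtain ⟨P, -, hdisj, hmeas, hP⟩ := exists_variation_le_add (μ : VectorMeasure T E)
    MeasurableSet.univ (ε := (ε / 2).toNNReal) (by simpa using hε) μ.2.ne
  have hP' : varNorm μ ≤ ∑ p ∈ P, ‖(μ : VectorMeasure T E) p‖ + ε / 2 := by
    have hsum : ∑ p ∈ P, ‖(μ : VectorMeasure T E) p‖ₑ ≠ ∞ := by simp
    have h1 := ENNReal.toReal_mono (ENNReal.add_ne_top.mpr ⟨hsum, ENNReal.coe_ne_top⟩) hP
    rw [ENNReal.toReal_add hsum ENNReal.coe_ne_top, ENNReal.toReal_sum (by simp)] at h1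
    simpa [varNorm, (half_pos hε).le] using h1
  -- The direction of `μ p`; since `0⁻¹ = 0`, it is zero when `μ p = 0`, and `hyi` still holds.
  let y : Set T → E := fun p => ((‖(μ : VectorMeasure T E) p‖⁻¹ : ℝ) : 𝕜) • (μ : VectorMeasure T E) p
  have hy : ∀ p, ‖y p‖ ≤ 1 := fun p => by
    simp only [y, norm_smul, RCLike.norm_ofReal, abs_inv, abs_norm]
    exact inv_mul_le_one
  have hyi : ∀ p, inner 𝕜 ((μ : VectorMeasure T E) p) (y p) =
      ((‖(μ : VectorMeasure T E) p‖ : ℝ) : 𝕜) := fun p => by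
    rw [inner_smul_right, inner_self_eq_norm_sq_to_K]
    rcases eq_or_ne ‖(μ : VectorMeasure T E) p‖ 0 with h0 | h0
    · simp [h0]
    · have : ((‖(μ : VectorMeasure T E) p‖ : ℝ) : 𝕜) ≠ 0 := by exact_mod_cast h0
      push_cast
      field_simp
  let g : T → E := fun t => ∑ p ∈ P, p.indicator (fun _ => y p) t
  have hint : ∀ p ∈ P, Integrable (p.indicator fun _ => y p)
      (μ : VectorMeasure T E).variation := fun p hp =>
    (integrable_const _).indicator (hmeas p hp)
  have hgint : Integrable g (μ : VectorMeasure T E).variation := integrable_finsetSum _ hint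
  have hg1 : ∀ t, ‖g t‖ ≤ 1 := fun t => by
    by_cases ht : ∃ p ∈ P, t ∈ p
    · obtain ⟨p, hp, htp⟩ := ht
      have h1 : g t = y p := by
        refine (Finset.sum_eq_single_of_mem p hp fun q hq hqp => ?_).trans (by simp [htp])
        exact Set.indicator_of_notMem
          (fun htq => Set.disjoint_left.mp (hdisj hq hp hqp) htq htp) _
      rw [h1]
      exact hy p
    · have h1 : g t = 0 := Finset.sum_eq_zero fun p hp =>
        Set.indicator_of_notMem (fun htp => ht ⟨p, hp, htp⟩) _
      simp [h1]
  have hgv : vint g μ = ((∑ p ∈ P, ‖(μ : VectorMeasure T E) p‖ : ℝ) : 𝕜) := by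
    refine (VectorMeasure.integral_finsetSum P hint).trans ?_
    push_cast
    exact Finset.sum_congr rfl fun p hp => (vint_indicator_const (hmeas p hp) _ μ).trans (hyi p)
  -- Continuous functions are dense in L¹; `ε / 4` becomes `ε / 2` after truncation to the unit
  -- ball.
  obtain ⟨k, hk, hkint⟩ := hgint.exists_boundedContinuous_integral_sub_le
    (show 0 < ε / 4 by positivity)
  let f : T → E := fun t => radialRetraction (k t)
  have hf : Continuous f := continuous_radialRetraction.comp k.continuous
  have hfint := integrable_variation hf μ
  have h1 : ‖vint f μ‖ ≤ a := h f hf fun t => norm_radialRetraction_le _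
  have h2 : vint (fun t => f t - g t) μ = vint f μ - vint g μ :=
    VectorMeasure.integral_fun_sub hfint hgint
  have h3 : ‖vint f μ - vint g μ‖ ≤ ε / 2 := by
    rw [← h2]
    refine (norm_vint_le_integral _ μ).trans ?_
    calc ∫ t, ‖f t - g t‖ ∂(μ : VectorMeasure T E).variation
        ≤ ∫ t, 2 * ‖g t - k t‖ ∂(μ : VectorMeasure T E).variation := by
          refine integral_mono (hfint.sub hgint).norm ((hgint.sub hkint).norm.const_mul 2)
            fun t => ?_
          rw [norm_sub_rev (g t)]
          exact norm_radialRetraction_sub_le _ (hg1 t)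
      _ = 2 * ∫ t, ‖g t - k t‖ ∂(μ : VectorMeasure T E).variation := integral_const_mul _ _
      _ ≤ ε / 2 := by linarith
  have h4 : ‖vint g μ‖ = ∑ p ∈ P, ‖(μ : VectorMeasure T E) p‖ := by
    rw [hgv, RCLike.norm_ofReal, abs_of_nonneg (Finset.sum_nonneg fun _ _ => norm_nonneg _)]
  have h5 := norm_sub_norm_le (vint g μ) (vint f μ)
  rw [norm_sub_rev] at h5
  linarith

/-- Both defining conditions are rewritten as closed conditions on the values of `f ↦ ∫ f dμ`, which
is what weak* closedness requires. -/
theorem mem_ballMass_iff (a : ℝ) (v : E) (μ : cabv 𝕜 T E) :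
    μ ∈ (ballMass a v : Set (cabv 𝕜 T E)) ↔
      (∀ f : C(T, E), (∀ x, ‖f x‖ ≤ 1) → ‖vint f μ‖ ≤ a) ∧
        ∀ x : E, vint (ContinuousMap.const T x) μ = inner 𝕜 v x := by
  have hc : ∀ x : E, vint (ContinuousMap.const T x) μ =
      inner 𝕜 ((μ : VectorMeasure T E) Set.univ) x := fun x => vint_const x μ
  simp only [hc]
  constructor
  · rintro ⟨h1, h2⟩
    refine ⟨fun f hf => (norm_vint_le hf μ).trans (by simpa using h1), fun x => by rw [h2]⟩
  · rintro ⟨h1, h2⟩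
    exact ⟨varNorm_le_of_forall_continuous fun f hf hf1 => h1 ⟨f, hf⟩ hf1, ext_inner_right 𝕜 h2⟩

theorem weakStarClosed_ballMass (a : ℝ) (v : E) :
    WeakStarClosed (ballMass a v : Set (cabv 𝕜 T E)) := by
  refine isClosed_induced_iff.mpr ⟨{φ | (∀ f : C(T, E), (∀ x, ‖f x‖ ≤ 1) → ‖φ f‖ ≤ a) ∧
    ∀ x : E, φ (ContinuousMap.const T x) = inner 𝕜 v x}, ?_, ?_⟩
  · rw [Set.ofPred_and]
    refine IsClosed.inter ?_ ?_
    · simp only [Set.ofPred_forall]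
      exact isClosed_iInter fun f => isClosed_iInter fun _ =>
        isClosed_le (continuous_apply f).norm continuous_const
    · simp only [Set.ofPred_forall]
      exact isClosed_iInter fun x => isClosed_eq (continuous_apply _) continuous_const
  · ext μ
    exact (mem_ballMass_iff a v μ).symm

end NormMK

/-! ### Weak* compactness of bounded sets -/

section WeakStarCompactness

open Filter VectorMeasure

variable {𝕜 : Type*} [RCLike 𝕜] {T : Type*} [MeasurableSpace T]
  {E : Type*} [NormedAddCommGroup E] [InnerProductSpace 𝕜 E] [NormedSpace ℝ E]
  [IsScalarTower ℝ 𝕜 E]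

/-- The vector measure `B ↦ p(B) b`. -/
noncomputable def smulVector (p : FiniteMeasure T) (b : E) : cabv 𝕜 T E :=
  ⟨mapCLM ((1 : ℝ →L[ℝ] ℝ).smulRight b) (p : Measure T).toSignedMeasure,
    variation_mapCLM_lt_top _ (by
      rw [Measure.variation_toSignedMeasure]
      exact measure_lt_top _ _)⟩

omit [IsScalarTower ℝ 𝕜 E] in
theorem smulVector_apply (p : FiniteMeasure T) (b : E) (s : Set T) :
    (smulVector p b : cabv 𝕜 T E).1 s = (p : Measure T).toSignedMeasure s • b := rfl

theorem vint_smulVector [TopologicalSpace T] [CompactSpace T] [BorelSpace T] [ProperSpace E]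
    {f : T → E} (hf : Continuous f) (p : FiniteMeasure T) (b : E) :
    vint f (smulVector p b : cabv 𝕜 T E) = ∫ t, inner 𝕜 b (f t) ∂(p : Measure T) := by
  let L' : E →L[ℝ] 𝕜 := (innerSL 𝕜 b).restrictScalars ℝ
  have hL : ∀ (x : E) (r : ℝ), pairing 𝕜 E x ((1 : ℝ →L[ℝ] ℝ).smulRight b r) =
      (ContinuousLinearMap.lsmul ℝ ℝ).flip (L' x) r := fun x r => by
    simp only [pairing_apply, ContinuousLinearMap.smulRight_apply, one_apply_eq_self,
      ContinuousLinearMap.flip_apply, ContinuousLinearMap.lsmul_apply, L',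
      ContinuousLinearMap.coe_restrictScalars', innerSL_apply_apply]
    rw [← algebraMap_smul 𝕜 r b, inner_smul_left]
    simp [RCLike.real_smul_eq_coe_mul]
  have hint : ((p : Measure T).toSignedMeasure).Integrable f := by
    rw [VectorMeasure.Integrable, Measure.variation_toSignedMeasure]
    exact integrable_of_continuous hf _
  exact (integral_mapCLM _ _ _ L' hL _ hint).trans integral_toSignedMeasure

omit [IsScalarTower ℝ 𝕜 E] in
/-- Every vector measure of finite variation is a combination of positive measures of controlled
mass, with coefficients from a fixed finite family of vectors. -/
theorem exists_eq_sum_smulVector {κ : Type*} [Fintype κ] (b : Module.Basis κ ℝ E)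
    (ℓ : κ → E →L[ℝ] ℝ) (hℓ : ∀ j x, ℓ j x = b.coord j x) (μ : cabv 𝕜 T E) :
    ∃ p q : κ → FiniteMeasure T,
      (∀ j, (p j).mass ≤ ‖ℓ j‖₊ * (varNorm μ).toNNReal) ∧
      (∀ j, (q j).mass ≤ ‖ℓ j‖₊ * (varNorm μ).toNNReal) ∧
      μ = ∑ j, (smulVector (p j) (b j) - smulVector (q j) (b j)) := by
  -- The coordinates of `μ` are signed measures; both Jordan parts are dominated by the total
  -- variation, at most `‖ℓ j‖ |μ|`.
  let s : κ → SignedMeasure T := fun j => mapCLM (ℓ j) (μ : VectorMeasure T E)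
  have hmass : ∀ j, (s j).totalVariation Set.univ ≤
      ((‖ℓ j‖₊ * (varNorm μ).toNNReal : NNReal) : ℝ≥0∞) := fun j => by
    rw [SignedMeasure.totalVariation_eq_variation]
    refine (variation_mapCLM_le (ℓ j) _ Set.univ).trans_eq ?_
    rw [Measure.smul_apply, smul_eq_mul, ENNReal.coe_mul, enorm_eq_nnnorm]
    congr 1
    exact (ENNReal.ofReal_toReal μ.2.ne).symm
  let p : κ → FiniteMeasure T := fun j => .mk (s j).toJordanDecomposition.posPart inferInstance
  let q : κ → FiniteMeasure T := fun j => .mk (s j).toJordanDecomposition.negPart inferInstance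
  refine ⟨p, q, fun j => ?_, fun j => ?_, ?_⟩
  · rw [← ENNReal.coe_le_coe, FiniteMeasure.ennreal_mass]
    exact (Measure.le_add_right le_rfl Set.univ).trans (hmass j)
  · rw [← ENNReal.coe_le_coe, FiniteMeasure.ennreal_mass]
    exact (Measure.le_add_left le_rfl Set.univ).trans (hmass j)
  · refine Subtype.ext (VectorMeasure.ext fun B hB => ?_)
    have h1 : ((∑ j, (smulVector (p j) (b j) - smulVector (q j) (b j)) : cabv 𝕜 T E) :
        VectorMeasure T E) B = ∑ j, s j B • b j := by
      rw [AddSubmonoidClass.coe_finsetSum, FunLike.coe_sum, Finset.sum_apply]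
      refine Finset.sum_congr rfl fun j _ => ?_
      rw [AddSubgroupClass.coe_sub, _root_.sub_apply, smulVector_apply, smulVector_apply, ← sub_smul]
      congr 1
      conv_rhs => rw [← (s j).toSignedMeasure_toJordanDecomposition]
      rfl
    rw [h1]
    conv_lhs => rw [← b.sum_repr ((μ : VectorMeasure T E) B)]
    refine Finset.sum_congr rfl fun j _ => ?_
    rw [mapCLM_apply, hℓ, Module.Basis.coord_apply]

variable [MetricSpace T] [CompactSpace T] [BorelSpace T] [ProperSpace E]

/-- On a compact space the finite measures of mass at most `C` form a weakly compact set, and an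
ultrafilter on a compact set converges. -/
theorem exists_tendsto_finiteMeasure {ι : Type*} (U : Ultrafilter ι) (p : ι → FiniteMeasure T)
    {C : NNReal} (hp : ∀ i, (p i).mass ≤ C) : ∃ q, Tendsto p U (𝓝 q) := by
  obtain ⟨q, -, hq⟩ := (isCompact_setOfPred_finiteMeasure_le_of_compactSpace T C).ultrafilter_le_nhds'
    (U.map p) (Filter.mem_map.mpr (Eventually.of_forall hp))
  exact ⟨q, hq⟩

/-- Bounded families of vector measures have weak* limits along ultrafilters. -/
theorem exists_tendsto_vint {ι : Type*} (U : Ultrafilter ι) (u : ι → cabv 𝕜 T E) {a : ℝ}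
    (hu : ∀ i, varNorm (u i) ≤ a) :
    ∃ μ : cabv 𝕜 T E, ∀ f : T → E, Continuous f →
      Tendsto (fun i => vint f (u i)) U (𝓝 (vint f μ)) := by
  have : FiniteDimensional ℝ E := FiniteDimensional.of_locallyCompactSpace ℝ
  let b := Module.finBasis ℝ E
  let ℓ : Fin (Module.finrank ℝ E) → E →L[ℝ] ℝ := fun j => (b.coord j).toContinuousLinearMap
  choose p q hp hq hpq using fun i => exists_eq_sum_smulVector b ℓ (fun _ _ => rfl) (u i)
  -- This mass bound is independent of `i`, so each of the finitely many coordinate families stays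
  -- in one compact set.
  have hle : ∀ i j, ‖ℓ j‖₊ * (varNorm (u i)).toNNReal ≤ ‖ℓ j‖₊ * a.toNNReal := fun i j =>
    mul_le_mul_right (Real.toNNReal_le_toNNReal (hu i)) _
  choose p' hp' using fun j => exists_tendsto_finiteMeasure U (fun i => p i j)
    fun i => (hp i j).trans (hle i j)
  choose q' hq' using fun j => exists_tendsto_finiteMeasure U (fun i => q i j)
    fun i => (hq i j).trans (hle i j)
  refine ⟨∑ j, (smulVector (p' j) (b j) - smulVector (q' j) (b j)), fun f hf => ?_⟩
  have hval : ∀ p q : Fin (Module.finrank ℝ E) → FiniteMeasure T,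
      vint f (∑ j, (smulVector (p j) (b j) - smulVector (q j) (b j)) : cabv 𝕜 T E) =
        ∑ j, ((∫ t, inner 𝕜 (b j) (f t) ∂(p j : Measure T)) -
          ∫ t, inner 𝕜 (b j) (f t) ∂(q j : Measure T)) := fun p q => by
    rw [vint_sum hf]
    refine Finset.sum_congr rfl fun j _ => ?_
    rw [vint_sub_right hf, vint_smulVector hf, vint_smulVector hf]
  have hu' : (fun i => vint f (u i)) = fun i => ∑ j,
      ((∫ t, inner 𝕜 (b j) (f t) ∂(p i j : Measure T)) -
        ∫ t, inner 𝕜 (b j) (f t) ∂(q i j : Measure T)) := by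
    ext i
    conv_lhs => rw [hpq i]
    exact hval _ _
  rw [hu', hval]
  refine tendsto_finsetSum _ fun j _ => ?_
  let g : BoundedContinuousFunction T 𝕜 :=
    BoundedContinuousFunction.mkOfCompact ⟨fun t => inner 𝕜 (b j) (f t), by fun_prop⟩
  exact ((FiniteMeasure.tendsto_iff_forall_integral_rclike_tendsto 𝕜).mp (hp' j) g).sub
    ((FiniteMeasure.tendsto_iff_forall_integral_rclike_tendsto 𝕜).mp (hq' j) g)

omit [CompactSpace T] [BorelSpace T] [ProperSpace E] in
theorem WeakStarClosed.mem_of_tendsto {ι : Type*} {l : Filter ι} [l.NeBot]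
    {A : Set (cabv 𝕜 T E)} (hA : WeakStarClosed A) {u : ι → cabv 𝕜 T E} {μ : cabv 𝕜 T E}
    (hu : ∀ i, u i ∈ A)
    (h : ∀ f : T → E, Continuous f → Tendsto (fun i => vint f (u i)) l (𝓝 (vint f μ))) :
    μ ∈ A := by
  obtain ⟨S, hS, rfl⟩ := isClosed_induced_iff.mp hA
  exact hS.mem_of_tendsto (tendsto_pi_nhds.mpr fun f : C(T, E) => h f f.continuous)
    (Eventually.of_forall hu)

end WeakStarCompactness

/-! ### The complete metric space `A` -/

section FixedPoint

open Filter

variable {𝕜 : Type*} [RCLike 𝕜] {T : Type*} [MeasurableSpace T] [MetricSpace T] [CompactSpace T]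
  [BorelSpace T] [Nonempty T] {E : Type*} [NormedAddCommGroup E] [InnerProductSpace 𝕜 E]
  [NormedSpace ℝ E] [IsScalarTower ℝ 𝕜 E] [ProperSpace E]
  {A : Set (cabv 𝕜 T E)} {a : ℝ} {v : E}

omit [MetricSpace T] [CompactSpace T] [BorelSpace T] [Nonempty T] [NormedSpace ℝ E]
  [IsScalarTower ℝ 𝕜 E] [ProperSpace E] in
theorem sub_univ_eq_zero (hA : A ⊆ ballMass a v) {μ ν : cabv 𝕜 T E} (hμ : μ ∈ A) (hν : ν ∈ A) :
    ((μ - ν : cabv 𝕜 T E) : VectorMeasure T E) Set.univ = 0 := by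
  rw [AddSubgroupClass.coe_sub, _root_.sub_apply, (hA hμ).2, (hA hν).2, sub_self]

/-- The metric `d*_MK` on a set of measures with the same total mass. -/
noncomputable abbrev metricSpaceMKStar (hA : A ⊆ ballMass a v) : MetricSpace A where
  dist μ ν := dMKStar μ.1 ν.1
  dist_self μ := by
    change normMKStar (μ.1 - μ.1) = 0
    rw [sub_self]
    refine le_antisymm (normMKStar_le fun f _ => ?_) (normMKStar_nonneg _)
    rw [vint_zero, norm_zero]
  dist_comm μ ν := by
    change normMKStar (μ.1 - ν.1) = normMKStar (ν.1 - μ.1)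
    rw [← normMKStar_neg, neg_sub]
  dist_triangle μ ν ρ := by
    change normMKStar (μ.1 - ρ.1) ≤ normMKStar (μ.1 - ν.1) + normMKStar (ν.1 - ρ.1)
    rw [← sub_add_sub_cancel μ.1 ν.1 ρ.1]
    exact normMKStar_add_le (sub_univ_eq_zero hA μ.2 ν.2) (sub_univ_eq_zero hA ν.2 ρ.2)
  eq_of_dist_eq_zero {μ ν} h :=
    Subtype.ext (sub_eq_zero.mp (eq_zero_of_normMKStar_eq_zero (sub_univ_eq_zero hA μ.2 ν.2) h))

/-- The distance is weak* lower semicontinuous, as a supremum of weak* continuous functions. Hence a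
Cauchy sequence converges in `d*_MK` to any weak* limit along an ultrafilter. -/
theorem completeSpace_metricSpaceMKStar (hA : A ⊆ ballMass a v) (hAc : WeakStarClosed A) :
    letI := metricSpaceMKStar hA
    CompleteSpace A := by
  let := metricSpaceMKStar hA
  refine Metric.complete_of_cauchySeq_tendsto fun u hu => ?_
  obtain ⟨μ, hμ⟩ := exists_tendsto_vint (hyperfilter ℕ) (fun k => (u k).1)
    fun k => (hA (u k).2).1
  have hμA : μ ∈ A := hAc.mem_of_tendsto (fun k => (u k).2) hμ
  refine ⟨⟨μ, hμA⟩, Metric.tendsto_atTop.mpr fun ε hε => ?_⟩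
  obtain ⟨N, hN⟩ := Metric.cauchySeq_iff.mp hu (ε / 2) (half_pos hε)
  refine ⟨N, fun k hk => lt_of_le_of_lt ?_ (half_lt_self hε)⟩
  change normMKStar ((u k).1 - μ) ≤ ε / 2
  refine normMKStar_le fun f hf => ?_
  rw [vint_sub_right hf.continuous]
  refine le_of_tendsto (tendsto_const_nhds.sub (hμ f hf.continuous)).norm ?_
  -- The hyperfilter contains every tail of `ℕ`, so the Cauchy bound holds along it.
  refine (Nat.hyperfilter_le_atTop : _ ≤ _) ((eventually_ge_atTop N).mono fun m hm => ?_)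
  rw [← vint_sub_right hf.continuous]
  exact (norm_vint_le_normMKStar_of_lipschitz_one (sub_univ_eq_zero hA (u k).2 (u m).2) hf).trans
    (hN k hk m hm).le

end FixedPoint

/-! ### Dirac masses and the constant `c` -/

theorem ballMass_nonempty {𝕜 T E : Type*} [RCLike 𝕜] [MeasurableSpace T] [Nonempty T]
    [NormedAddCommGroup E] [NormedSpace 𝕜 E] {a : ℝ} {v : E} (hv : ‖v‖ ≤ a) :
    (ballMass a v : Set (cabv 𝕜 T E)).Nonempty := by
  let x₀ : T := Classical.arbitrary T
  have h1 : (VectorMeasure.dirac x₀ v).variation Set.univ = ‖v‖ₑ := by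
    simp [VectorMeasure.variation_dirac]
  refine ⟨⟨VectorMeasure.dirac x₀ v, ?_⟩, ?_, ?_⟩
  · change (VectorMeasure.dirac x₀ v).variation Set.univ < ∞
    rw [h1]
    exact enorm_lt_top
  · change ((VectorMeasure.dirac x₀ v).variation Set.univ).toReal ≤ a
    rw [h1, toReal_enorm]
    exact hv
  · simp

theorem summable_norm_mul_lipConst {T F : Type*} [MetricSpace T] [NormedAddCommGroup F]
    {ω : ℕ → T → T} (hr : BddAbove (Set.range fun i => lipConst (ω i))) {R : ℕ → F}
    (hR : Summable fun i => ‖R i‖) : Summable fun i => ‖R i‖ * lipConst (ω i) := by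
  obtain ⟨M, hM⟩ := hr
  exact Summable.of_nonneg_of_le (fun i => mul_nonneg (norm_nonneg _) (lipConst_nonneg _))
    (fun i => mul_le_mul_of_nonneg_left (hM ⟨i, rfl⟩) (norm_nonneg _)) (hR.mul_right M)

theorem tsum_norm_mul_lipConst_lt_one {T F : Type*} [MetricSpace T] [NormedAddCommGroup F]
    {ω : ℕ → T → T} (hω : ∀ i, lipConst (ω i) < 1) {R : ℕ → F} (hR : ∑' i, ‖R i‖ = 1) :
    ∑' i, ‖R i‖ * lipConst (ω i) < 1 := by
  -- A divergent series has `tsum` equal to `0`, not `1`.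
  have hRs : Summable fun i => ‖R i‖ := by
    by_contra h
    rw [tsum_eq_zero_of_not_summable h] at hR
    exact zero_ne_one hR
  have hs := summable_norm_mul_lipConst (ω := ω) ⟨1, by rintro _ ⟨i, rfl⟩; exact (hω i).le⟩ hRs
  -- Strict inequality needs one index with nonzero weight.
  obtain ⟨i, hi⟩ : ∃ i, ‖R i‖ ≠ 0 := by
    by_contra! h
    simp [h] at hR
  rw [← hR]
  exact hs.tsum_lt_tsum (fun j => mul_le_of_le_one_right (norm_nonneg _) (hω j).le)
    (mul_lt_of_lt_one_right ((norm_nonneg _).lt_of_ne' hi) (hω i)) hRs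

end SelfSimilar

/-! ### The main theorem -/

theorem theorem3p2p1 {𝕜 : Type*} [RCLike 𝕜] {T : Type*} [MetricSpace T] [CompactSpace T]
    [Nontrivial T] [MeasurableSpace T] [BorelSpace T] (n : ℕ) (hn : 1 ≤ n)
    (ω : ℕ → T → T) (hω : ∀ i, ∃ K, LipschitzWith K (ω i))
    (hr : BddAbove (Set.range fun i => SelfSimilar.lipConst (ω i)))
    (R : ℕ → EuclideanSpace 𝕜 (Fin n) →L[𝕜] EuclideanSpace 𝕜 (Fin n))
    (hR : Summable fun i => ‖R i‖)
    (c : ℝ) (hc : c = ∑' i, ‖R i‖ * SelfSimilar.lipConst (ω i))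
    (H : SelfSimilar.cabv 𝕜 T (EuclideanSpace 𝕜 (Fin n)) →
      SelfSimilar.cabv 𝕜 T (EuclideanSpace 𝕜 (Fin n)))
    (hH : H = SelfSimilar.markov R ω hR fun i => (hω i).choose_spec.continuous.measurable) :
    -- the sufficient condition for `c < 1`
    ((∀ i, SelfSimilar.lipConst (ω i) < 1) → ∑' i, ‖R i‖ = 1 → c < 1) ∧
    -- `B_a(K^n, v)` is not empty
    (∀ (a : ℝ) (v : EuclideanSpace 𝕜 (Fin n)), 0 < a → ‖v‖ ≤ a →
      (SelfSimilar.ballMass a v :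
        Set (SelfSimilar.cabv 𝕜 T (EuclideanSpace 𝕜 (Fin n)))).Nonempty) ∧
    -- the sufficient condition for `H` not to increase the variational norm
    (∑' i, ‖R i‖ = 1 → ∀ μ, SelfSimilar.varNorm (H μ) ≤ SelfSimilar.varNorm μ) ∧
    (∑' i, R i = ContinuousLinearMap.id 𝕜 (EuclideanSpace 𝕜 (Fin n)) →
      ∀ (a : ℝ) (v : EuclideanSpace 𝕜 (Fin n)), 0 < a → ‖v‖ ≤ a →
        -- in that case `A = B_a(K^n, v)` is admissible
        ((∀ μ, SelfSimilar.varNorm (H μ) ≤ SelfSimilar.varNorm μ) →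
          Set.MapsTo H (SelfSimilar.ballMass a v) (SelfSimilar.ballMass a v) ∧
          SelfSimilar.WeakStarClosed
            (SelfSimilar.ballMass a v :
              Set (SelfSimilar.cabv 𝕜 T (EuclideanSpace 𝕜 (Fin n))))) ∧
        -- `H` is a contraction of every admissible `A`, with a unique invariant measure in `A`
        (c < 1 →
          ∀ A : Set (SelfSimilar.cabv 𝕜 T (EuclideanSpace 𝕜 (Fin n))),
            A.Nonempty → A ⊆ SelfSimilar.ballMass a v →
            ∀ hA : Set.MapsTo H A A, SelfSimilar.WeakStarClosed A →
              (∃ m : MetricSpace A,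
                (∀ μ ν : A, dist μ ν = SelfSimilar.dMKStar μ.1 ν.1) ∧
                ContractingWith (Real.toNNReal c) (hA.restrict H A A)) ∧
              ∃! μ, μ ∈ A ∧ H μ = μ)) := by
  have hs := SelfSimilar.summable_norm_mul_lipConst hr hR
  subst hH
  refine ⟨fun h1 h2 => hc ▸ SelfSimilar.tsum_norm_mul_lipConst_lt_one h1 h2,
    fun a v _ hv => SelfSimilar.ballMass_nonempty hv, fun h1 μ => ?_,
    fun hid a v _ _ => ⟨fun hle => ⟨fun μ hμ => ⟨(hle μ).trans hμ.1, ?_⟩,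
      SelfSimilar.weakStarClosed_ballMass a v⟩, fun hc1 A hne hAB hA hAc => ?_⟩⟩
  · simpa [h1] using SelfSimilar.varNorm_markov_le R ω hR _ μ
  · rw [SelfSimilar.markov_univ, hid, hμ.2, ContinuousLinearMap.id_apply]
  · let m := SelfSimilar.metricSpaceMKStar hAB
    have hcompl : CompleteSpace A := SelfSimilar.completeSpace_metricSpaceMKStar hAB hAc
    -- Nonnegativity ensures that `Real.toNNReal c` is `c` itself and not a truncation.
    have hc0 : 0 ≤ c := hc ▸ tsum_nonneg fun i =>
      mul_nonneg (norm_nonneg _) (SelfSimilar.lipConst_nonneg _)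
    have hcontr : ContractingWith (Real.toNNReal c) (hA.restrict _ A A) := by
      refine ⟨by simpa using hc1, LipschitzWith.of_dist_le_mul fun μ ν => ?_⟩
      rw [Real.coe_toNNReal c hc0, hc]
      change SelfSimilar.normMKStar (SelfSimilar.markov R ω hR _ μ.1 -
        SelfSimilar.markov R ω hR _ ν.1) ≤ _ * SelfSimilar.normMKStar (μ.1 - ν.1)
      rw [← SelfSimilar.markov_sub]
      exact SelfSimilar.normMKStar_markov_le R ω hR _ hω hs
        (SelfSimilar.sub_univ_eq_zero hAB μ.2 ν.2)
    refine ⟨⟨m, fun _ _ => rfl, hcontr⟩, ?_⟩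
    have : Nonempty A := hne.to_subtype
    refine ⟨hcontr.fixedPoint, ⟨Subtype.property _,
      congrArg Subtype.val hcontr.fixedPoint_isFixedPt⟩, fun μ hμ => ?_⟩
    exact congrArg Subtype.val (hcontr.fixedPoint_unique (x := ⟨μ, hμ.1⟩) (Subtype.ext hμ.2))
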